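/- **Base category.** Let $\mathcal S$ be a small category with finite products (final object $*$) and an initial object $\emptyset$, equipped with two subcategories $\mathcal S^{sm}$ (smooth morphisms) and $\mathcal S^{cl}$ (closed immersions), having all objects and containing all isomorphisms, such that: the fibered product of a smooth morphism with any morphism exists, and any base change of a smooth morphism is smooth; a base change of a closed immersion along a smooth morphism is a closed immersion; if $g\circ z$ is a closed immersion, so is $z$; every morphism is of the form $p\circ t$ with $t$ a closed immersion and $p$ smooth. Let $\mathcal U\subset\mathcal S$ be the full subcategory of the objects $Y$ with $Y\to *$ smooth. Assume also that every closed immersion $z:Z\to S$ has a complementary open immersion, i.e. a smooth $u:U\to S$ such that $u\circ -$ identifies $\mathrm{Hom}(T,U)$, for every $T$, with the set of $f:T\to S$ for which $\emptyset$ (with its unique maps to $T$ and $Z$) is the fibered product $T\times_S Z$; and that for every $S$ there are $n\ge 0$ and closed immersions $\emptyset=Z_{-1}\to Z_0\to\cdots\to Z_n=S$ such that the open complement of $Z_{r-1}$ in $Z_r$ lies in $\mathcal U$ for $0\le r\le n$. **Fibered categories.** A triangulated $\mathcal S$-fibered category $\mathbb H$ consists of triangulated categories $\mathbb H(S)$,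 triangulated functors $f^*:\mathbb H(S)\to\mathbb H(T)$ for $f:T\to S$ with $\mathrm{id}_S^*=\mathrm{id}$, and isomorphisms of triangulated functors $(gf)^*\simeq f^*g^*$ satisfying the cocycle condition for three composable morphisms. It is localic if: $\mathbb H(\emptyset)=0$; for $p$ smooth, $p^*$ has a left adjoint $p_\#$, and for every Cartesian square $p\circ f'=f\circ p'$ with $p$ smooth the base change morphism $p'_\#f'^*\to f^*p_\#$ is invertible; for $z$ a closed immersion, $z^*$ has a fully faithful right adjoint $z_*$; and for $z$ a closed immersion with complementary open immersion $u$, the pair $(z^*,u^*)$ is conservative. A triangulated morphism $R:\mathbb H_1\to\mathbb H_2$ consists of triangulated functors $R_S:\mathbb H_1(S)\to\mathbb H_2(S)$ and isomorphisms of triangulated functors $\theta_f:f^*R_S\simeq R_Tf^*$ for $f:T\to S$, compatible with composition. It is localic if for every smooth $p:P\to S$ the induced morphism $p_\#R_P\to R_Sp_\#$ is invertible. A triangulated internal tensor structure $(\otimes,m)$ on $\mathbb H$ consists of triangulated bifunctors $\otimes$ on each $\mathbb H(S)$ (triangulated in each variable, with the two shift isomorphisms compatible up to the usual sign) and natural isomorphisms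 $m_f:f^*A\otimes f^*B\simeq f^*(A\otimes B)$, compatible with shifts in each variable and with composition of morphisms. It is localic if for every smooth $p:P\to S$ the projection morphisms $p_\#(A\otimes p^*B)\to p_\#A\otimes B$ and $p_\#(p^*A\otimes B)\to A\otimes p_\#B$ are invertible. Given such structures $(\otimes_i,m_i)$ on $\mathbb H_i$ ($i=1,2$), a triangulated internal tensor structure $\rho$ on $R$ is a family of isomorphisms $\rho_S:R_S(A)\otimes_2R_S(B)\simeq R_S(A\otimes_1B)$, natural in $A,B\in\mathbb H_1(S)$ and compatible with the shifts in each variable, such that for every $f:T\to S$ the two composites $$f^*R_S(A)\otimes_2f^*R_S(B)\xrightarrow{m_2}f^*(R_S(A)\otimes_2R_S(B))\xrightarrow{\rho}f^*R_S(A\otimes_1B)\xrightarrow{\theta}R_T(f^*(A\otimes_1B))$$ $$f^*R_S(A)\otimes_2f^*R_S(B)\xrightarrow{\theta\otimes\theta}R_T(f^*A)\otimes_2R_T(f^*B)\xrightarrow{\rho}R_T(f^*A\otimes_1f^*B)\xrightarrow{m_1}R_T(f^*(A\otimes_1B))$$ coincide. All these notions make sense over $\mathcal U$ as well, and restrict from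 $\mathcal S$ to $\mathcal U$. **Theorem.** Let $\mathbb H_1,\mathbb H_2$ be localic triangulated $\mathcal S$-fibered categories with localic triangulated internal tensor structures $(\otimes_1,m_1)$, $(\otimes_2,m_2)$, and let $R:\mathbb H_1\to\mathbb H_2$ be a localic morphism. Let $\rho$ be a triangulated internal tensor structure on the restriction of $R$ to $\mathcal U$. Then there exists a unique triangulated internal tensor structure $\tilde\rho$ on $R$ (over $\mathcal S$) whose restriction to $\mathcal U$ equals $\rho$. -/

import Mathlib

open CategoryTheory CategoryTheory.Limits

universe v u w₁ w₁' w₂ w₂'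

namespace LocalicFibered

section Base

/-! ### The base category -/

variable {𝒮 : Type u} [Category.{v} 𝒮]

/-- Standing hypotheses on the classes `sm` of smooth morphisms and `cl` of closed immersions
of `𝒮`: each of them is a subcategory with the same objects containing all isomorphisms, smooth
morphisms can be pulled back, closed immersions are stable under pullback along smooth morphisms
and satisfy the usual cancellation property, and every morphism is a closed immersion followed by
a smooth morphism. -/
structure IsFactorizationSetting (sm cl : MorphismProperty 𝒮) : Prop where
  sm_multiplicative : sm.IsMultiplicative
  cl_multiplicative : cl.IsMultiplicative
  isos_le_sm : MorphismProperty.isomorphisms 𝒮 ≤ sm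
  isos_le_cl : MorphismProperty.isomorphisms 𝒮 ≤ cl
  hasPullback_of_sm : ∀ {P S T : 𝒮} (p : P ⟶ S) (f : T ⟶ S), sm p → HasPullback p f
  sm_of_isPullback : ∀ {PT P T S : 𝒮} {f' : PT ⟶ P} {p' : PT ⟶ T} {p : P ⟶ S} {f : T ⟶ S},
    IsPullback f' p' p f → sm p → sm p'
  cl_of_isPullback : ∀ {PZ P Z S : 𝒮} {z' : PZ ⟶ P} {p' : PZ ⟶ Z} {p : P ⟶ S} {z : Z ⟶ S},
    IsPullback z' p' p z → sm p → cl z → cl z'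
  cl_of_comp : ∀ {Z S V : 𝒮} (z : Z ⟶ S) (g : S ⟶ V), cl (z ≫ g) → cl z
  exists_factorization : ∀ {T S : 𝒮} (f : T ⟶ S),
    ∃ (P : 𝒮) (t : T ⟶ P) (p : P ⟶ S), cl t ∧ sm p ∧ t ≫ p = f

/-- The class of objects whose morphism to the final object is smooth; the associated full
subcategory is `𝒰`. -/
def smoothObjects [HasFiniteProducts 𝒮] (sm : MorphismProperty 𝒮) : ObjectProperty 𝒮 :=
  fun Y => sm (terminal.from Y)

/-- `u : U ⟶ S` is an open immersion complementary to `z : Z ⟶ S`: it is smooth, and composition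
with `u` identifies `Hom(T, U)` with the set of those `f : T ⟶ S` whose pullback along `z` is the
initial object. -/
structure IsOpenComplement [HasInitial 𝒮] (sm : MorphismProperty 𝒮) {Z U S : 𝒮}
    (z : Z ⟶ S) (u : U ⟶ S) : Prop where
  smooth : sm u
  injective : ∀ {T : 𝒮} (g g' : T ⟶ U), g ≫ u = g' ≫ u → g = g'
  factors_iff : ∀ {T : 𝒮} (f : T ⟶ S),
    (∃ g : T ⟶ U, g ≫ u = f) ↔ IsPullback (initial.to T) (initial.to Z) f z

/-- Further standing hypotheses: there is an initial object, every closed immersion has a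
complementary open immersion, and every object `S` has a finite filtration
`∅ = Z₋₁ ⟶ Z₀ ⟶ ⋯ ⟶ Zₙ = S` by closed immersions whose successive open complements are smooth
objects (in the indexing below, `Z r` stands for `Zᵣ₋₁`). -/
structure IsStratifiedSetting [HasFiniteProducts 𝒮] [HasInitial 𝒮]
    (sm cl : MorphismProperty 𝒮) : Prop extends IsFactorizationSetting sm cl where
  exists_openComplement : ∀ {Z S : 𝒮} (z : Z ⟶ S), cl z →
    ∃ (U : 𝒮) (u : U ⟶ S), IsOpenComplement sm z u
  exists_stratification : ∀ S : 𝒮, ∃ (n : ℕ) (Z : Fin (n + 2) → 𝒮)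
    (z : ∀ r : Fin (n + 1), Z r.castSucc ⟶ Z r.succ),
    Nonempty (IsInitial (Z 0)) ∧ Z (Fin.last (n + 1)) = S ∧
      ∀ r, cl (z r) ∧ ∃ (U : 𝒮) (u : U ⟶ Z r.succ),
        IsOpenComplement sm (z r) u ∧ smoothObjects sm U

end Base

section Fibered

/-! ### Triangulated fibered categories -/

variable {𝒮 : Type u} [Category.{v} 𝒮]

/-- A triangulated `𝒮`-fibered category with fibers the triangulated categories `H S`: triangulated
inverse image functors `pull f` for `f : T ⟶ S`, and connection isomorphisms `(gf)^* ≅ f^* g^*`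
which respect the triangulated structures and satisfy the cocycle condition.

The connection isomorphism at a pair `(f, g)` is indexed by the commutative triangle `f ≫ g = h`,
which is the same datum as indexing it by `(f, g)`. -/
structure FiberedCategory (H : 𝒮 → Type w₁) [∀ S, Category.{w₁'} (H S)] [∀ S, HasZeroObject (H S)]
    [∀ S, HasShift (H S) ℤ] [∀ S, Preadditive (H S)]
    [∀ S, ∀ n : ℤ, (shiftFunctor (H S) n).Additive]
    [∀ S, Pretriangulated (H S)] [∀ S, IsTriangulated (H S)] where
  pull {T S : 𝒮} (f : T ⟶ S) : H S ⥤ H T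
  [pullShift {T S : 𝒮} (f : T ⟶ S) : (pull f).CommShift ℤ]
  pull_isTriangulated {T S : 𝒮} (f : T ⟶ S) : (pull f).IsTriangulated
  conn {T S V : 𝒮} {f : T ⟶ S} {g : S ⟶ V} {h : T ⟶ V} (w : f ≫ g = h) :
    pull h ≅ pull g ⋙ pull f
  conn_commShift {T S V : 𝒮} {f : T ⟶ S} {g : S ⟶ V} {h : T ⟶ V} (w : f ≫ g = h) :
    NatTrans.CommShift (conn w).hom ℤ
  pull_id (S : 𝒮) : pull (𝟙 S) = 𝟭 (H S)
  conn_assoc {T S V W : 𝒮} {f : T ⟶ S} {g : S ⟶ V} {h : V ⟶ W} {fg : T ⟶ V} {gh : S ⟶ W}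
    {fgh : T ⟶ W} (hfg : f ≫ g = fg) (hgh : g ≫ h = gh) (h₁ : fg ≫ h = fgh) (h₂ : f ≫ gh = fgh)
    (A : H W) :
    (conn h₂).hom.app A ≫ (pull f).map ((conn hgh).hom.app A) =
      (conn h₁).hom.app A ≫ (conn hfg).hom.app ((pull h).obj A)

attribute [instance] FiberedCategory.pullShift
attribute [instance] FiberedCategory.pull_isTriangulated FiberedCategory.conn_commShift

variable {H : 𝒮 → Type w₁} [∀ S, Category.{w₁'} (H S)] [∀ S, HasZeroObject (H S)]
  [∀ S, HasShift (H S) ℤ] [∀ S, Preadditive (H S)]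
  [∀ S, ∀ n : ℤ, (shiftFunctor (H S) n).Additive]
  [∀ S, Pretriangulated (H S)] [∀ S, IsTriangulated (H S)]

namespace FiberedCategory

variable (ℍ : FiberedCategory H)

/-- The base change morphism `p'_# f'^* A ⟶ f^* p_# A` of a commutative square `f' ≫ p = p' ≫ f`,
for given left adjoints `p_#` of `p^*` and `p'_#` of `p'^*`. -/
def baseChange {PT P T S : 𝒮} {f' : PT ⟶ P} {p' : PT ⟶ T} {p : P ⟶ S} {f : T ⟶ S}
    (sq : f' ≫ p = p' ≫ f) {L : H P ⥤ H S} (adj : L ⊣ ℍ.pull p) {L' : H PT ⥤ H T}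
    (adj' : L' ⊣ ℍ.pull p') (A : H P) :
    L'.obj ((ℍ.pull f').obj A) ⟶ (ℍ.pull f).obj (L.obj A) :=
  L'.map ((ℍ.pull f').map (adj.unit.app A)) ≫
    L'.map ((ℍ.conn sq).inv.app (L.obj A)) ≫
    L'.map ((ℍ.conn rfl).hom.app (L.obj A)) ≫
    adj'.counit.app ((ℍ.pull f).obj (L.obj A))

/-- Localic triangulated fibered categories, with respect to the classes `sm` of smooth morphisms
and `cl` of closed immersions. -/
structure IsLocalic [HasInitial 𝒮] (sm cl : MorphismProperty 𝒮) : Prop where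
  isZero_initial : ∀ A : H (⊥_ 𝒮), IsZero A
  isRightAdjoint_pull : ∀ {P S : 𝒮} (p : P ⟶ S), sm p → (ℍ.pull p).IsRightAdjoint
  isIso_baseChange : ∀ {PT P T S : 𝒮} {f' : PT ⟶ P} {p' : PT ⟶ T} {p : P ⟶ S} {f : T ⟶ S}
    (sq : IsPullback f' p' p f), sm p →
    ∀ (L : H P ⥤ H S) (adj : L ⊣ ℍ.pull p) (L' : H PT ⥤ H T) (adj' : L' ⊣ ℍ.pull p') (A : H P),
      IsIso (ℍ.baseChange sq.w adj adj' A)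
  exists_rightAdjoint_pull : ∀ {Z S : 𝒮} (z : Z ⟶ S), cl z →
    ∃ (G : H Z ⥤ H S) (_ : ℍ.pull z ⊣ G), G.Full ∧ G.Faithful
  conservative : ∀ {Z U S : 𝒮} (z : Z ⟶ S) (u : U ⟶ S), cl z → IsOpenComplement sm z u →
    ∀ {A B : H S} (φ : A ⟶ B),
      IsIso ((ℍ.pull z).map φ) → IsIso ((ℍ.pull u).map φ) → IsIso φ

/-- The restriction of a fibered category to a full subcategory of the base. -/
@[reducible]
def restrict (P : ObjectProperty 𝒮) :
    FiberedCategory (𝒮 := P.FullSubcategory) (fun S => H S.obj) where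
  pull f := ℍ.pull f.hom
  pullShift f := ℍ.pullShift f.hom
  pull_isTriangulated f := ℍ.pull_isTriangulated f.hom
  conn {_ _ _ f g h} w := ℍ.conn (f := f.hom) (g := g.hom) (h := h.hom) (by rw [← w]; rfl)
  conn_commShift {_ _ _ f g h} w :=
    ℍ.conn_commShift (f := f.hom) (g := g.hom) (h := h.hom) (by rw [← w]; rfl)
  pull_id S := ℍ.pull_id S.obj
  conn_assoc {_ _ _ _ f g h fg gh fgh} hfg hgh h₁ h₂ A :=
    ℍ.conn_assoc (f := f.hom) (g := g.hom) (h := h.hom) (fg := fg.hom) (gh := gh.hom)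
      (fgh := fgh.hom) (by rw [← hfg]; rfl) (by rw [← hgh]; rfl) (by rw [← h₁]; rfl)
      (by rw [← h₂]; rfl) A

end FiberedCategory

/-! ### Triangulated internal tensor structures -/

/-- A triangulated internal tensor structure on a triangulated fibered category: a triangulated
bifunctor `- ⊗ -` on each fiber (triangulated in each variable, the two shift isomorphisms being
compatible up to the usual sign `(-1)^(pq)`), and monoidality isomorphisms
`f^* A ⊗ f^* B ≅ f^* (A ⊗ B)` which are natural in `A` and `B`, respect the shifts in each
variable, and satisfy the cocycle condition. -/
structure TensorStructure (ℍ : FiberedCategory H) where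
  tensor (S : 𝒮) : H S ⥤ H S ⥤ H S
  [tensorShift (S : 𝒮) : (tensor S).CommShift₂Int]
  tensor_isTriangulated_right (S : 𝒮) (A : H S) : ((tensor S).obj A).IsTriangulated
  tensor_isTriangulated_left (S : 𝒮) (B : H S) : ((tensor S).flip.obj B).IsTriangulated
  /-- `f^* A ⊗ f^* B ≅ f^* (A ⊗ B)`, natural in `B` -/
  mon {T S : 𝒮} (f : T ⟶ S) (A : H S) :
    ℍ.pull f ⋙ (tensor T).obj ((ℍ.pull f).obj A) ≅ (tensor S).obj A ⋙ ℍ.pull f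
  /-- naturality in `A` -/
  mon_naturality {T S : 𝒮} (f : T ⟶ S) {A A' : H S} (a : A ⟶ A') (B : H S) :
    ((tensor T).map ((ℍ.pull f).map a)).app ((ℍ.pull f).obj B) ≫ (mon f A').hom.app B =
      (mon f A).hom.app B ≫ (ℍ.pull f).map (((tensor S).map a).app B)
  mon_commShift_right {T S : 𝒮} (f : T ⟶ S) (A : H S) : NatTrans.CommShift (mon f A).hom ℤ
  mon_commShift_left {T S : 𝒮} (f : T ⟶ S) (B : H S) :
    NatTrans.CommShift
      ({ app := fun A => (mon f A).hom.app B
         naturality := fun _ _ a => mon_naturality f a B } :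
        ℍ.pull f ⋙ (tensor T).flip.obj ((ℍ.pull f).obj B) ⟶ (tensor S).flip.obj B ⋙ ℍ.pull f) ℤ
  mon_comp {T S V : 𝒮} {f : T ⟶ S} {g : S ⟶ V} {h : T ⟶ V} (w : f ≫ g = h) (A B : H V) :
    (mon h A).hom.app B ≫ (ℍ.conn w).hom.app (((tensor V).obj A).obj B) =
      ((tensor T).map ((ℍ.conn w).hom.app A)).app ((ℍ.pull h).obj B) ≫
        ((tensor T).obj ((ℍ.pull f).obj ((ℍ.pull g).obj A))).map ((ℍ.conn w).hom.app B) ≫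
        (mon f ((ℍ.pull g).obj A)).hom.app ((ℍ.pull g).obj B) ≫
        (ℍ.pull f).map ((mon g A).hom.app B)

attribute [instance] TensorStructure.tensorShift
attribute [instance] TensorStructure.tensor_isTriangulated_right
  TensorStructure.tensor_isTriangulated_left

namespace TensorStructure

variable {ℍ : FiberedCategory H} (𝒯 : TensorStructure ℍ)

/-- The projection morphism `p_# (A ⊗ p^* B) ⟶ p_# A ⊗ B`. -/
def projLeft {P S : 𝒮} {p : P ⟶ S} {L : H P ⥤ H S} (adj : L ⊣ ℍ.pull p) (A : H P) (B : H S) :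
    L.obj (((𝒯.tensor P).obj A).obj ((ℍ.pull p).obj B)) ⟶ ((𝒯.tensor S).obj (L.obj A)).obj B :=
  L.map (((𝒯.tensor P).map (adj.unit.app A)).app ((ℍ.pull p).obj B)) ≫
    L.map ((𝒯.mon p (L.obj A)).hom.app B) ≫
    adj.counit.app (((𝒯.tensor S).obj (L.obj A)).obj B)

/-- The projection morphism `p_# (p^* A ⊗ B) ⟶ A ⊗ p_# B`. -/
def projRight {P S : 𝒮} {p : P ⟶ S} {L : H P ⥤ H S} (adj : L ⊣ ℍ.pull p) (A : H S) (B : H P) :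
    L.obj (((𝒯.tensor P).obj ((ℍ.pull p).obj A)).obj B) ⟶ ((𝒯.tensor S).obj A).obj (L.obj B) :=
  L.map (((𝒯.tensor P).obj ((ℍ.pull p).obj A)).map (adj.unit.app B)) ≫
    L.map ((𝒯.mon p A).hom.app (L.obj B)) ≫
    adj.counit.app (((𝒯.tensor S).obj A).obj (L.obj B))

/-- A triangulated internal tensor structure is localic if it satisfies the projection formulae
along smooth morphisms. -/
structure IsLocalic (sm : MorphismProperty 𝒮) : Prop where
  isIso_projLeft : ∀ {P S : 𝒮} (p : P ⟶ S), sm p → ∀ (L : H P ⥤ H S) (adj : L ⊣ ℍ.pull p)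
    (A : H P) (B : H S), IsIso (𝒯.projLeft adj A B)
  isIso_projRight : ∀ {P S : 𝒮} (p : P ⟶ S), sm p → ∀ (L : H P ⥤ H S) (adj : L ⊣ ℍ.pull p)
    (A : H S) (B : H P), IsIso (𝒯.projRight adj A B)

/-- The restriction of a tensor structure to a full subcategory of the base. -/
@[reducible]
def restrict (P : ObjectProperty 𝒮) : TensorStructure (ℍ.restrict P) where
  tensor S := 𝒯.tensor S.obj
  tensorShift S := 𝒯.tensorShift S.obj
  tensor_isTriangulated_right S := 𝒯.tensor_isTriangulated_right S.obj
  tensor_isTriangulated_left S := 𝒯.tensor_isTriangulated_left S.obj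
  mon f := 𝒯.mon f.hom
  mon_naturality f := 𝒯.mon_naturality f.hom
  mon_commShift_right f := 𝒯.mon_commShift_right f.hom
  mon_commShift_left f := 𝒯.mon_commShift_left f.hom
  mon_comp {_ _ _ f g h} w :=
    𝒯.mon_comp (f := f.hom) (g := g.hom) (h := h.hom) (by rw [← w]; rfl)

end TensorStructure

/-! ### Triangulated morphisms of fibered categories -/

variable {H' : 𝒮 → Type w₂} [∀ S, Category.{w₂'} (H' S)] [∀ S, HasZeroObject (H' S)]
  [∀ S, HasShift (H' S) ℤ] [∀ S, Preadditive (H' S)]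
  [∀ S, ∀ n : ℤ, (shiftFunctor (H' S) n).Additive]
  [∀ S, Pretriangulated (H' S)] [∀ S, IsTriangulated (H' S)]

/-- A triangulated morphism of triangulated fibered categories: triangulated functors `R_S` on
the fibers and transition isomorphisms `θ_f : f^* R_S ≅ R_T f^*` which respect the triangulated
structures and satisfy the cocycle condition. -/
structure FiberedMorphism (ℍ₁ : FiberedCategory H) (ℍ₂ : FiberedCategory H') where
  functor (S : 𝒮) : H S ⥤ H' S
  [functorShift (S : 𝒮) : (functor S).CommShift ℤ]
  functor_isTriangulated (S : 𝒮) : (functor S).IsTriangulated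
  trans {T S : 𝒮} (f : T ⟶ S) : functor S ⋙ ℍ₂.pull f ≅ ℍ₁.pull f ⋙ functor T
  trans_commShift {T S : 𝒮} (f : T ⟶ S) : NatTrans.CommShift (trans f).hom ℤ
  trans_comp {T S V : 𝒮} {f : T ⟶ S} {g : S ⟶ V} {h : T ⟶ V} (w : f ≫ g = h) (A : H V) :
    (trans h).hom.app A ≫ (functor T).map ((ℍ₁.conn w).hom.app A) =
      (ℍ₂.conn w).hom.app ((functor V).obj A) ≫
        (ℍ₂.pull f).map ((trans g).hom.app A) ≫
        (trans f).hom.app ((ℍ₁.pull g).obj A)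

attribute [instance] FiberedMorphism.functorShift
attribute [instance] FiberedMorphism.functor_isTriangulated FiberedMorphism.trans_commShift

namespace FiberedMorphism

variable {ℍ₁ : FiberedCategory H} {ℍ₂ : FiberedCategory H'} (R : FiberedMorphism ℍ₁ ℍ₂)

/-- The exchange morphism `p_# R_P A ⟶ R_S p_# A`, for given left adjoints of the functors
`p^*` on both sides. -/
def exchange {P S : 𝒮} {p : P ⟶ S} {L₁ : H P ⥤ H S} (adj₁ : L₁ ⊣ ℍ₁.pull p)
    {L₂ : H' P ⥤ H' S} (adj₂ : L₂ ⊣ ℍ₂.pull p) (A : H P) :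
    L₂.obj ((R.functor P).obj A) ⟶ (R.functor S).obj (L₁.obj A) :=
  L₂.map ((R.functor P).map (adj₁.unit.app A)) ≫
    L₂.map ((R.trans p).inv.app (L₁.obj A)) ≫
    adj₂.counit.app ((R.functor S).obj (L₁.obj A))

/-- A triangulated morphism is localic if the exchange morphisms along smooth morphisms are
invertible. -/
def IsLocalic (sm : MorphismProperty 𝒮) : Prop :=
  ∀ {P S : 𝒮} (p : P ⟶ S), sm p →
    ∀ (L₁ : H P ⥤ H S) (adj₁ : L₁ ⊣ ℍ₁.pull p) (L₂ : H' P ⥤ H' S) (adj₂ : L₂ ⊣ ℍ₂.pull p)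
      (A : H P), IsIso (R.exchange adj₁ adj₂ A)

/-- The restriction of a morphism to a full subcategory of the base. -/
@[reducible]
def restrict (P : ObjectProperty 𝒮) : FiberedMorphism (ℍ₁.restrict P) (ℍ₂.restrict P) where
  functor S := R.functor S.obj
  functorShift S := R.functorShift S.obj
  functor_isTriangulated S := R.functor_isTriangulated S.obj
  trans f := R.trans f.hom
  trans_commShift f := R.trans_commShift f.hom
  trans_comp {_ _ _ f g h} w :=
    R.trans_comp (f := f.hom) (g := g.hom) (h := h.hom) (by rw [← w]; rfl)

end FiberedMorphism

/-! ### Triangulated internal tensor structures on morphisms -/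

/-- A triangulated internal tensor structure on a morphism `R`, with respect to tensor structures
`𝒯₁` and `𝒯₂` on its source and target: isomorphisms `ρ_S : R_S A ⊗ R_S B ≅ R_S (A ⊗ B)`, natural
in `A` and `B`, which respect the shifts in each variable and are compatible with inverse image
functors. -/
@[ext]
structure MorphismTensorStructure {ℍ₁ : FiberedCategory H} {ℍ₂ : FiberedCategory H'}
    (R : FiberedMorphism ℍ₁ ℍ₂) (𝒯₁ : TensorStructure ℍ₁) (𝒯₂ : TensorStructure ℍ₂) where
  /-- `R_S A ⊗ R_S B ≅ R_S (A ⊗ B)`, natural in `B` -/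
  rho (S : 𝒮) (A : H S) :
    R.functor S ⋙ (𝒯₂.tensor S).obj ((R.functor S).obj A) ≅
      (𝒯₁.tensor S).obj A ⋙ R.functor S
  /-- naturality in `A` -/
  rho_naturality (S : 𝒮) {A A' : H S} (a : A ⟶ A') (B : H S) :
    ((𝒯₂.tensor S).map ((R.functor S).map a)).app ((R.functor S).obj B) ≫ (rho S A').hom.app B =
      (rho S A).hom.app B ≫ (R.functor S).map (((𝒯₁.tensor S).map a).app B)
  rho_commShift_right (S : 𝒮) (A : H S) : NatTrans.CommShift (rho S A).hom ℤ
  rho_commShift_left (S : 𝒮) (B : H S) :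
    NatTrans.CommShift
      ({ app := fun A => (rho S A).hom.app B
         naturality := fun _ _ a => rho_naturality S a B } :
        R.functor S ⋙ (𝒯₂.tensor S).flip.obj ((R.functor S).obj B) ⟶
          (𝒯₁.tensor S).flip.obj B ⋙ R.functor S) ℤ
  rho_pull {T S : 𝒮} (f : T ⟶ S) (A B : H S) :
    (𝒯₂.mon f ((R.functor S).obj A)).hom.app ((R.functor S).obj B) ≫
        (ℍ₂.pull f).map ((rho S A).hom.app B) ≫
        (R.trans f).hom.app (((𝒯₁.tensor S).obj A).obj B) =
      ((𝒯₂.tensor T).map ((R.trans f).hom.app A)).app ((ℍ₂.pull f).obj ((R.functor S).obj B)) ≫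
        ((𝒯₂.tensor T).obj ((R.functor T).obj ((ℍ₁.pull f).obj A))).map
          ((R.trans f).hom.app B) ≫
        (rho T ((ℍ₁.pull f).obj A)).hom.app ((ℍ₁.pull f).obj B) ≫
        (R.functor T).map ((𝒯₁.mon f A).hom.app B)

/-- The restriction of a tensor structure on a morphism to a full subcategory of the base. -/
@[reducible]
def MorphismTensorStructure.restrict {ℍ₁ : FiberedCategory H} {ℍ₂ : FiberedCategory H'}
    {R : FiberedMorphism ℍ₁ ℍ₂} {𝒯₁ : TensorStructure ℍ₁} {𝒯₂ : TensorStructure ℍ₂}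
    (ρ : MorphismTensorStructure R 𝒯₁ 𝒯₂) (P : ObjectProperty 𝒮) :
    MorphismTensorStructure (R.restrict P) (𝒯₁.restrict P) (𝒯₂.restrict P) where
  rho S := ρ.rho S.obj
  rho_naturality S := ρ.rho_naturality S.obj
  rho_commShift_right S := ρ.rho_commShift_right S.obj
  rho_commShift_left S := ρ.rho_commShift_left S.obj
  rho_pull f := ρ.rho_pull f.hom

end Fibered

end LocalicFibered

/-! Every object S has a closed immersion e : S ⟶ Y into a smooth object. Since e_* is fully
faithful on the source, the counit e^* e_* ⟶ id is invertible and e^* is essentially surjective.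
Compatibility along e, whose transition and monoidality maps are invertible, prescribes an extension
of ρ on the objects e^* M, hence, by naturality, everywhere. This gives uniqueness, and it also
gives a construction: pull ρ_Y(e_* A, e_* B) back to S and conjugate by the counits
(`TensorFamily.IsNatural.exists_pull`).

The result does not depend on e. For any f : S ⟶ X with X smooth, the map (e, f) : S ⟶ Y × X is
again a closed immersion into a smooth object. The family built from it is compatible with ρ along e
and along f, because ρ is compatible with both projections, and uniqueness along e identifies it
with the original family. So the family over S is compatible with ρ along every map to a smooth
object (`IsExtensionAlong.of_closed`). Compatibility with an arbitrary f : T ⟶ S then follows by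
comparing e with f ≫ e on the essential image of e^*. Invertibility and compatibility with shifts
likewise hold on that essential image and spread to all objects by naturality. -/

namespace LocalicFibered

/-! ### Closed embeddings into smooth objects -/

section Geometry

variable {𝒮 : Type u} [Category.{v} 𝒮] [HasFiniteProducts 𝒮] {sm cl : MorphismProperty 𝒮}

/-- Every object embeds into a smooth object. -/
lemma IsFactorizationSetting.exists_embedding (h : IsFactorizationSetting sm cl) (S : 𝒮) :
    ∃ (Y : 𝒮) (e : S ⟶ Y), cl e ∧ smoothObjects sm Y := by
  obtain ⟨Y, e, p, he, hp, -⟩ := h.exists_factorization (terminal.from S)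
  refine ⟨Y, e, he, ?_⟩
  rwa [smoothObjects, Subsingleton.elim (terminal.from Y) p]

/-- A product of two smooth objects is smooth. -/
lemma IsFactorizationSetting.smoothObjects_prod (h : IsFactorizationSetting sm cl) {X Y : 𝒮}
    (hX : smoothObjects sm X) (hY : smoothObjects sm Y) : smoothObjects sm (X ⨯ Y) := by
  have := h.sm_multiplicative
  have sq : IsPullback (prod.snd : X ⨯ Y ⟶ Y) prod.fst (terminal.from Y) (terminal.from X) :=
    (IsPullback.of_is_product (prodIsProd X Y) terminalIsTerminal).flip
  have := sm.comp_mem _ _ (h.sm_of_isPullback sq hY) hX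
  rwa [smoothObjects, Subsingleton.elim (terminal.from (X ⨯ Y)) (prod.fst ≫ terminal.from X)]

/-- Lifting a closed immersion to a product gives a closed immersion. -/
lemma IsFactorizationSetting.cl_lift (h : IsFactorizationSetting sm cl) {S X Y : 𝒮}
    {e : S ⟶ X} (he : cl e) (f : S ⟶ Y) : cl (prod.lift e f) :=
  h.cl_of_comp _ prod.fst (by rwa [prod.lift_fst])

end Geometry

/-- Shift compatibility is an equation between natural maps, so it may be tested on objects
isomorphic to some `F.obj M`; fullness of `F` plays no role. -/
lemma commShift_of_whiskerLeft {C D E : Type*} [Category C] [Category D] [Category E]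
    [HasShift C ℤ] [HasShift D ℤ] [HasShift E ℤ] (F : C ⥤ D) [F.CommShift ℤ] [F.EssSurj]
    {G₁ G₂ : D ⥤ E} [G₁.CommShift ℤ] [G₂.CommShift ℤ] (τ : G₁ ⟶ G₂)
    [h : NatTrans.CommShift (Functor.whiskerLeft F τ) ℤ] : NatTrans.CommShift τ ℤ := by
  refine ⟨fun n => ?_⟩
  ext A
  -- The shift isomorphism of `F` enters both sides of the whiskered equation; naturality of `τ`
  -- moves it to the front, where it cancels.
  have key (M : C) : (G₁.commShiftIso n).hom.app (F.obj M) ≫ (τ.app (F.obj M))⟦n⟧' =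
      τ.app ((F.obj M)⟦n⟧) ≫ (G₂.commShiftIso n).hom.app (F.obj M) := by
    have := NatTrans.shift_app_comm (Functor.whiskerLeft F τ) n M
    simp only [Functor.commShiftIso_comp_hom_app, Functor.whiskerLeft_app, Category.assoc] at this
    rw [← cancel_epi (G₁.map ((F.commShiftIso n).hom.app M)), this]
    exact (τ.naturality_assoc _ _).symm
  have i := F.objObjPreimageIso A
  dsimp
  rw [← cancel_epi (G₁.map (i.hom⟦n⟧')), Functor.commShiftIso_hom_naturality_assoc,
    ← Functor.map_comp, τ.naturality, Functor.map_comp, reassoc_of% (key _),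
    τ.naturality_assoc, Functor.commShiftIso_hom_naturality]

section Fibered

variable {𝒮 : Type u} [Category.{v} 𝒮]
variable {H : 𝒮 → Type w₁} [∀ S, Category.{w₁'} (H S)] [∀ S, HasZeroObject (H S)]
  [∀ S, HasShift (H S) ℤ] [∀ S, Preadditive (H S)]
  [∀ S, ∀ n : ℤ, (shiftFunctor (H S) n).Additive]
  [∀ S, Pretriangulated (H S)] [∀ S, IsTriangulated (H S)]

/-- Full faithfulness of z_* makes the counit z^* z_* A ⟶ A invertible. -/
lemma FiberedCategory.IsLocalic.essSurj [HasInitial 𝒮] {sm cl : MorphismProperty 𝒮}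
    {ℍ : FiberedCategory H} (h : ℍ.IsLocalic sm cl) {Z S : 𝒮} {z : Z ⟶ S} (hz : cl z) :
    (ℍ.pull z).EssSurj := by
  obtain ⟨G, adj, _, _⟩ := h.exists_rightAdjoint_pull z hz
  exact ⟨fun A => ⟨G.obj A, ⟨asIso (adj.counit.app A)⟩⟩⟩

/-! ### Two-variable form of the tensor product and of monoidality -/

namespace TensorStructure

variable {ℍ : FiberedCategory H} (𝒯 : TensorStructure ℍ)

/-- The tensor product of two objects. -/
abbrev tens {S : 𝒮} (A B : H S) : H S := ((𝒯.tensor S).obj A).obj B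

/-- The tensor product of two morphisms. -/
def tmap {S : 𝒮} {A A' B B' : H S} (a : A ⟶ A') (b : B ⟶ B') : 𝒯.tens A B ⟶ 𝒯.tens A' B' :=
  ((𝒯.tensor S).map a).app B ≫ ((𝒯.tensor S).obj A').map b

@[simp]
lemma tmap_id {S : 𝒮} (A B : H S) : 𝒯.tmap (𝟙 A) (𝟙 B) = 𝟙 _ := by simp [tmap]

lemma tmap_comp {S : 𝒮} {A A' A'' B B' B'' : H S} (a : A ⟶ A') (a' : A' ⟶ A'') (b : B ⟶ B')
    (b' : B' ⟶ B'') : 𝒯.tmap (a ≫ a') (b ≫ b') = 𝒯.tmap a b ≫ 𝒯.tmap a' b' := by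
  simp [tmap]

lemma tmap_comp_assoc {S : 𝒮} {A A' A'' B B' B'' : H S} (a : A ⟶ A') (a' : A' ⟶ A'')
    (b : B ⟶ B') (b' : B' ⟶ B'') {Z : H S} (h : 𝒯.tens A'' B'' ⟶ Z) :
    𝒯.tmap (a ≫ a') (b ≫ b') ≫ h = 𝒯.tmap a b ≫ 𝒯.tmap a' b' ≫ h := by
  rw [tmap_comp, Category.assoc]

instance {S : 𝒮} {A A' B B' : H S} (a : A ⟶ A') (b : B ⟶ B') [IsIso a] [IsIso b] :
    IsIso (𝒯.tmap a b) := by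
  unfold tmap; infer_instance

lemma tmap_id_right {S : 𝒮} {A A' : H S} (a : A ⟶ A') (B : H S) :
    𝒯.tmap a (𝟙 B) = ((𝒯.tensor S).map a).app B := by simp [tmap]

lemma tmap_id_left {S : 𝒮} (A : H S) {B B' : H S} (b : B ⟶ B') :
    𝒯.tmap (𝟙 A) b = ((𝒯.tensor S).obj A).map b := by simp [tmap]

/-- The monoidality isomorphism at a pair of objects. -/
abbrev monApp {T S : 𝒮} (f : T ⟶ S) (A B : H S) :
    𝒯.tens ((ℍ.pull f).obj A) ((ℍ.pull f).obj B) ⟶ (ℍ.pull f).obj (𝒯.tens A B) :=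
  (𝒯.mon f A).hom.app B

lemma tmap_monApp {T S : 𝒮} (f : T ⟶ S) {A A' B B' : H S} (a : A ⟶ A') (b : B ⟶ B') :
    𝒯.tmap ((ℍ.pull f).map a) ((ℍ.pull f).map b) ≫ 𝒯.monApp f A' B' =
      𝒯.monApp f A B ≫ (ℍ.pull f).map (𝒯.tmap a b) := by
  have h₁ := (𝒯.mon f A').hom.naturality b
  have h₂ := 𝒯.mon_naturality f a B
  dsimp at h₁
  simp only [tmap, Category.assoc, h₁, reassoc_of% h₂, Functor.map_comp]

lemma tmap_monApp_assoc {T S : 𝒮} (f : T ⟶ S) {A A' B B' : H S} (a : A ⟶ A') (b : B ⟶ B')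
    {Z : H T} (h : (ℍ.pull f).obj (𝒯.tens A' B') ⟶ Z) :
    𝒯.tmap ((ℍ.pull f).map a) ((ℍ.pull f).map b) ≫ 𝒯.monApp f A' B' ≫ h =
      𝒯.monApp f A B ≫ (ℍ.pull f).map (𝒯.tmap a b) ≫ h := by
  rw [← Category.assoc, tmap_monApp, Category.assoc]

lemma monApp_comp {T S V : 𝒮} {f : T ⟶ S} {g : S ⟶ V} {h : T ⟶ V} (w : f ≫ g = h) (A B : H V) :
    𝒯.monApp h A B ≫ (ℍ.conn w).hom.app (𝒯.tens A B) =
      𝒯.tmap ((ℍ.conn w).hom.app A) ((ℍ.conn w).hom.app B) ≫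
        𝒯.monApp f ((ℍ.pull g).obj A) ((ℍ.pull g).obj B) ≫ (ℍ.pull f).map (𝒯.monApp g A B) := by
  rw [tmap, Category.assoc]
  exact 𝒯.mon_comp w A B

end TensorStructure

variable {H' : 𝒮 → Type w₂} [∀ S, Category.{w₂'} (H' S)] [∀ S, HasZeroObject (H' S)]
  [∀ S, HasShift (H' S) ℤ] [∀ S, Preadditive (H' S)]
  [∀ S, ∀ n : ℤ, (shiftFunctor (H' S) n).Additive]
  [∀ S, Pretriangulated (H' S)] [∀ S, IsTriangulated (H' S)]
  {ℍ₁ : FiberedCategory H} {ℍ₂ : FiberedCategory H'}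

/-! ### Natural families and their transport along inverse images -/

namespace FiberedMorphism

variable (R : FiberedMorphism ℍ₁ ℍ₂)

/-- The transition isomorphism at an object. -/
abbrev transApp {T S : 𝒮} (f : T ⟶ S) (A : H S) :
    (ℍ₂.pull f).obj ((R.functor S).obj A) ⟶ (R.functor T).obj ((ℍ₁.pull f).obj A) :=
  (R.trans f).hom.app A

lemma transApp_naturality {T S : 𝒮} (f : T ⟶ S) {A B : H S} (a : A ⟶ B) :
    (ℍ₂.pull f).map ((R.functor S).map a) ≫ R.transApp f B =
      R.transApp f A ≫ (R.functor T).map ((ℍ₁.pull f).map a) :=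
  (R.trans f).hom.naturality a

variable (𝒯₁ : TensorStructure ℍ₁) (𝒯₂ : TensorStructure ℍ₂)

/-- Families of morphisms `R_S A ⊗ R_S B ⟶ R_S (A ⊗ B)`. -/
abbrev TensorFamily (S : 𝒮) :=
  ∀ A B : H S, 𝒯₂.tens ((R.functor S).obj A) ((R.functor S).obj B) ⟶
    (R.functor S).obj (𝒯₁.tens A B)

variable {R 𝒯₁ 𝒯₂}

/-- Naturality of a family in both variables. -/
def TensorFamily.IsNatural {S : 𝒮} (σ : TensorFamily R 𝒯₁ 𝒯₂ S) : Prop :=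
  ∀ ⦃A A' B B' : H S⦄ (a : A ⟶ A') (b : B ⟶ B'),
    𝒯₂.tmap ((R.functor S).map a) ((R.functor S).map b) ≫ σ A' B' =
      σ A B ≫ (R.functor S).map (𝒯₁.tmap a b)

/-- Two natural families which agree on the essential image of a functor coincide as soon as this
functor is essentially surjective. -/
lemma TensorFamily.IsNatural.ext_of_essSurj {S : 𝒮} {σ τ : TensorFamily R 𝒯₁ 𝒯₂ S}
    (hσ : σ.IsNatural) (hτ : τ.IsNatural) {C : Type*} [Category C] (F : C ⥤ H S) [F.EssSurj]
    (h : ∀ M N, σ (F.obj M) (F.obj N) = τ (F.obj M) (F.obj N)) : σ = τ := by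
  ext A B
  rw [← cancel_epi (𝒯₂.tmap ((R.functor S).map (F.objObjPreimageIso A).hom)
    ((R.functor S).map (F.objObjPreimageIso B).hom)), hσ, hτ, h]

variable (R 𝒯₁ 𝒯₂)

/-- Compatibility with the inverse image along `f` of a morphism `R_S A ⊗ R_S B ⟶ R_S (A ⊗ B)` and
a morphism `R_T f^* A ⊗ R_T f^* B ⟶ R_T (f^* A ⊗ f^* B)`. -/
def PullCompatible {T S : 𝒮} (f : T ⟶ S) {A B : H S}
    (x : 𝒯₂.tens ((R.functor S).obj A) ((R.functor S).obj B) ⟶ (R.functor S).obj (𝒯₁.tens A B))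
    (y : 𝒯₂.tens ((R.functor T).obj ((ℍ₁.pull f).obj A)) ((R.functor T).obj ((ℍ₁.pull f).obj B)) ⟶
      (R.functor T).obj (𝒯₁.tens ((ℍ₁.pull f).obj A) ((ℍ₁.pull f).obj B))) : Prop :=
  𝒯₂.monApp f _ _ ≫ (ℍ₂.pull f).map x ≫ R.transApp f _ =
    𝒯₂.tmap (R.transApp f A) (R.transApp f B) ≫ y ≫ (R.functor T).map (𝒯₁.monApp f A B)

/-- The morphism over `T` compatible with a given one over `S`. -/
noncomputable def pullBack {T S : 𝒮} (f : T ⟶ S) {A B : H S}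
    (x : 𝒯₂.tens ((R.functor S).obj A) ((R.functor S).obj B) ⟶ (R.functor S).obj (𝒯₁.tens A B)) :
    𝒯₂.tens ((R.functor T).obj ((ℍ₁.pull f).obj A)) ((R.functor T).obj ((ℍ₁.pull f).obj B)) ⟶
      (R.functor T).obj (𝒯₁.tens ((ℍ₁.pull f).obj A) ((ℍ₁.pull f).obj B)) :=
  inv (𝒯₂.tmap (R.transApp f A) (R.transApp f B)) ≫ 𝒯₂.monApp f _ _ ≫ (ℍ₂.pull f).map x ≫
    R.transApp f _ ≫ inv ((R.functor T).map (𝒯₁.monApp f A B))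

variable {R 𝒯₁ 𝒯₂}

/-- The maps surrounding `y` in the compatibility square are invertible, so `x` determines `y`. The
converse determination is not available, as f^* need not be faithful. -/
lemma pullCompatible_iff {T S : 𝒮} {f : T ⟶ S} {A B : H S}
    {x : 𝒯₂.tens ((R.functor S).obj A) ((R.functor S).obj B) ⟶ (R.functor S).obj (𝒯₁.tens A B)}
    {y : 𝒯₂.tens ((R.functor T).obj ((ℍ₁.pull f).obj A)) ((R.functor T).obj ((ℍ₁.pull f).obj B)) ⟶
      (R.functor T).obj (𝒯₁.tens ((ℍ₁.pull f).obj A) ((ℍ₁.pull f).obj B))} :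
    PullCompatible R 𝒯₁ 𝒯₂ f x y ↔ y = pullBack R 𝒯₁ 𝒯₂ f x := by
  rw [PullCompatible, pullBack, IsIso.eq_inv_comp, ← cancel_mono ((R.functor T).map
    (𝒯₁.monApp f A B))]
  simp [eq_comm]

lemma pullCompatible_congr {T S : 𝒮} {f : T ⟶ S} {A B : H S}
    {x : 𝒯₂.tens ((R.functor S).obj A) ((R.functor S).obj B) ⟶ (R.functor S).obj (𝒯₁.tens A B)}
    {y y' : 𝒯₂.tens ((R.functor T).obj ((ℍ₁.pull f).obj A))
      ((R.functor T).obj ((ℍ₁.pull f).obj B)) ⟶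
      (R.functor T).obj (𝒯₁.tens ((ℍ₁.pull f).obj A) ((ℍ₁.pull f).obj B))}
    (h : PullCompatible R 𝒯₁ 𝒯₂ f x y) (h' : PullCompatible R 𝒯₁ 𝒯₂ f x y') : y = y' := by
  rw [pullCompatible_iff] at h h'
  rw [h, h']

lemma isIso_of_pullCompatible {T S : 𝒮} {f : T ⟶ S} {A B : H S}
    {x : 𝒯₂.tens ((R.functor S).obj A) ((R.functor S).obj B) ⟶ (R.functor S).obj (𝒯₁.tens A B)}
    {y : 𝒯₂.tens ((R.functor T).obj ((ℍ₁.pull f).obj A)) ((R.functor T).obj ((ℍ₁.pull f).obj B)) ⟶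
      (R.functor T).obj (𝒯₁.tens ((ℍ₁.pull f).obj A) ((ℍ₁.pull f).obj B))}
    (h : PullCompatible R 𝒯₁ 𝒯₂ f x y) [IsIso x] : IsIso y := by
  rw [pullCompatible_iff.1 h, pullBack]
  infer_instance

/-- Compatibility is natural in both objects. -/
lemma PullCompatible.of_iso {T S : 𝒮} {f : T ⟶ S} {σ : TensorFamily R 𝒯₁ 𝒯₂ S}
    (hσ : σ.IsNatural) {τ : TensorFamily R 𝒯₁ 𝒯₂ T} (hτ : τ.IsNatural) {A A' B B' : H S}
    (a : A ≅ A') (b : B ≅ B') (h : PullCompatible R 𝒯₁ 𝒯₂ f (σ A B) (τ _ _)) :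
    PullCompatible R 𝒯₁ 𝒯₂ f (σ A' B') (τ _ _) := by
  unfold PullCompatible at h ⊢
  -- Precomposing with the isomorphism induced by `a` and `b` lets naturality carry both sides back
  -- to the square at `A`, `B`.
  rw [← cancel_epi (𝒯₂.tmap ((ℍ₂.pull f).map ((R.functor S).map a.hom))
    ((ℍ₂.pull f).map ((R.functor S).map b.hom))), 𝒯₂.tmap_monApp_assoc, ← Functor.map_comp_assoc,
    hσ, Functor.map_comp_assoc, R.transApp_naturality, reassoc_of% h, ← 𝒯₂.tmap_comp_assoc,
    R.transApp_naturality, R.transApp_naturality, 𝒯₂.tmap_comp_assoc, reassoc_of% (hτ _ _),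
    ← Functor.map_comp, ← Functor.map_comp, 𝒯₁.tmap_monApp]

/-- Compatibility along a composition. -/
lemma pullCompatible_comp_iff {T S V : 𝒮} {f : T ⟶ S} {g : S ⟶ V} {h : T ⟶ V} (w : f ≫ g = h)
    {A B : H V}
    {x : 𝒯₂.tens ((R.functor V).obj A) ((R.functor V).obj B) ⟶ (R.functor V).obj (𝒯₁.tens A B)}
    {y : 𝒯₂.tens ((R.functor S).obj ((ℍ₁.pull g).obj A)) ((R.functor S).obj ((ℍ₁.pull g).obj B)) ⟶
      (R.functor S).obj (𝒯₁.tens ((ℍ₁.pull g).obj A) ((ℍ₁.pull g).obj B))}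
    (hxy : PullCompatible R 𝒯₁ 𝒯₂ g x y)
    {τ : TensorFamily R 𝒯₁ 𝒯₂ T} (hτ : τ.IsNatural) :
    PullCompatible R 𝒯₁ 𝒯₂ f y (τ _ _) ↔ PullCompatible R 𝒯₁ 𝒯₂ h x (τ _ _) := by
  have hθ (A : H V) : R.transApp h A ≫ (R.functor T).map ((ℍ₁.conn w).hom.app A) =
      (ℍ₂.conn w).hom.app _ ≫ (ℍ₂.pull f).map (R.transApp g A) ≫ R.transApp f _ :=
    R.trans_comp w A
  -- Up to the connection isomorphisms, each side of the square for `h` is the corresponding side of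
  -- the square for `f`, framed by the same isomorphisms. On this side `hxy` trades `x` for `y`; on
  -- the other, naturality of `τ` absorbs the connection maps. Cancelling the frame gives both
  -- implications.
  have lhs : (𝒯₂.monApp h _ _ ≫ (ℍ₂.pull h).map x ≫ R.transApp h _) ≫
      (R.functor T).map ((ℍ₁.conn w).hom.app (𝒯₁.tens A B)) =
      𝒯₂.tmap ((ℍ₂.conn w).hom.app _) ((ℍ₂.conn w).hom.app _) ≫
        𝒯₂.tmap ((ℍ₂.pull f).map (R.transApp g A)) ((ℍ₂.pull f).map (R.transApp g B)) ≫
        (𝒯₂.monApp f _ _ ≫ (ℍ₂.pull f).map y ≫ R.transApp f _) ≫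
        (R.functor T).map ((ℍ₁.pull f).map (𝒯₁.monApp g A B)) := by
    have n₁ := (ℍ₂.conn w).hom.naturality x
    dsimp at n₁
    have m := 𝒯₂.monApp_comp w ((R.functor V).obj A) ((R.functor V).obj B)
    simp only [Category.assoc, hθ]
    rw [reassoc_of% n₁, reassoc_of% m, ← R.transApp_naturality, 𝒯₂.tmap_monApp_assoc]
    simp only [← Functor.map_comp_assoc]
    rw [hxy]
  have rhs : (𝒯₂.tmap (R.transApp h A) (R.transApp h B) ≫ τ _ _ ≫
      (R.functor T).map (𝒯₁.monApp h A B)) ≫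
      (R.functor T).map ((ℍ₁.conn w).hom.app (𝒯₁.tens A B)) =
      𝒯₂.tmap ((ℍ₂.conn w).hom.app _) ((ℍ₂.conn w).hom.app _) ≫
        𝒯₂.tmap ((ℍ₂.pull f).map (R.transApp g A)) ((ℍ₂.pull f).map (R.transApp g B)) ≫
        (𝒯₂.tmap (R.transApp f _) (R.transApp f _) ≫ τ _ _ ≫
          (R.functor T).map (𝒯₁.monApp f _ _)) ≫
        (R.functor T).map ((ℍ₁.pull f).map (𝒯₁.monApp g A B)) := by
    simp only [Category.assoc]
    rw [← Functor.map_comp, 𝒯₁.monApp_comp w, Functor.map_comp, ← reassoc_of% (hτ _ _),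
      ← 𝒯₂.tmap_comp_assoc, hθ, hθ, 𝒯₂.tmap_comp_assoc, 𝒯₂.tmap_comp_assoc, Functor.map_comp]
    rfl
  unfold PullCompatible
  rw [← cancel_mono ((R.functor T).map ((ℍ₁.conn w).hom.app (𝒯₁.tens A B))), lhs, rhs,
    cancel_epi, cancel_epi, cancel_mono]

/-- Only morphisms of the form f^* a are reached here. Naturality against all morphisms over `T`
needs the right adjoint, since f^* need not be full. -/
lemma pullBack_naturality {T S : 𝒮} (f : T ⟶ S) {σ : TensorFamily R 𝒯₁ 𝒯₂ S} (hσ : σ.IsNatural)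
    {A A' B B' : H S} (a : A ⟶ A') (b : B ⟶ B') :
    𝒯₂.tmap ((R.functor T).map ((ℍ₁.pull f).map a)) ((R.functor T).map ((ℍ₁.pull f).map b)) ≫
        pullBack R 𝒯₁ 𝒯₂ f (σ A' B') =
      pullBack R 𝒯₁ 𝒯₂ f (σ A B) ≫
        (R.functor T).map (𝒯₁.tmap ((ℍ₁.pull f).map a) ((ℍ₁.pull f).map b)) := by
  have h := pullCompatible_iff.2 (rfl : pullBack R 𝒯₁ 𝒯₂ f (σ A B) = _)
  have h' := pullCompatible_iff.2 (rfl : pullBack R 𝒯₁ 𝒯₂ f (σ A' B') = _)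
  unfold PullCompatible at h h'
  rw [← cancel_epi (𝒯₂.tmap (R.transApp f A) (R.transApp f B)),
    ← cancel_mono ((R.functor T).map (𝒯₁.monApp f A' B'))]
  simp only [Category.assoc]
  rw [← Functor.map_comp, 𝒯₁.tmap_monApp, Functor.map_comp, ← reassoc_of% h,
    ← R.transApp_naturality, ← 𝒯₂.tmap_comp_assoc, ← R.transApp_naturality,
    ← R.transApp_naturality, 𝒯₂.tmap_comp_assoc, ← h', 𝒯₂.tmap_monApp_assoc,
    ← Functor.map_comp_assoc, ← Functor.map_comp_assoc, hσ]

/-- A natural family over `S` induces a compatible natural family over `T` whenever the inverse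
image functor has a fully faithful right adjoint. -/
lemma TensorFamily.IsNatural.exists_pull {T S : 𝒮} (f : T ⟶ S) {σ : TensorFamily R 𝒯₁ 𝒯₂ S}
    (hσ : σ.IsNatural) {G : H T ⥤ H S} (adj : ℍ₁.pull f ⊣ G) [G.Full] [G.Faithful] :
    ∃ τ : TensorFamily R 𝒯₁ 𝒯₂ T, τ.IsNatural ∧
      ∀ A B, PullCompatible R 𝒯₁ 𝒯₂ f (σ A B) (τ _ _) := by
  let ε := adj.counit
  -- The counits identify `A` and `B` with f^* of objects over `S`, where the value is forced.
  let τ : TensorFamily R 𝒯₁ 𝒯₂ T := fun A B =>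
    inv (𝒯₂.tmap ((R.functor T).map (ε.app A)) ((R.functor T).map (ε.app B))) ≫
      pullBack R 𝒯₁ 𝒯₂ f (σ (G.obj A) (G.obj B)) ≫
      (R.functor T).map (𝒯₁.tmap (ε.app A) (ε.app B))
  refine ⟨τ, fun A A' B B' a b => ?_, fun A B => ?_⟩
  -- Conjugation by the counits turns `a` into f^*(G a), for which naturality of the pullback is
  -- known.
  · have na := ε.naturality a
    have nb := ε.naturality b
    dsimp at na nb
    dsimp only [τ]
    rw [← cancel_epi (𝒯₂.tmap ((R.functor T).map (ε.app A)) ((R.functor T).map (ε.app B)))]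
    simp only [Category.assoc, IsIso.hom_inv_id_assoc]
    rw [← 𝒯₂.tmap_comp_assoc, ← Functor.map_comp, ← Functor.map_comp, ← na, ← nb,
      Functor.map_comp, Functor.map_comp, 𝒯₂.tmap_comp_assoc, IsIso.hom_inv_id_assoc,
      reassoc_of% (pullBack_naturality f hσ (G.map a) (G.map b)), ← Functor.map_comp,
      ← Functor.map_comp, ← 𝒯₁.tmap_comp, ← 𝒯₁.tmap_comp, na, nb]
  · rw [pullCompatible_iff]
    -- At objects f^* A, the triangle identity makes f^* of the unit inverse to the counit, so
    -- naturality along the units removes the conjugation.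
    have key := pullBack_naturality f hσ (adj.unit.app A) (adj.unit.app B)
    have t (A) : (ℍ₁.pull f).map (adj.unit.app A) ≫ ε.app ((ℍ₁.pull f).obj A) = 𝟙 _ :=
      adj.left_triangle_components A
    dsimp only [τ]
    have e : 𝒯₂.tmap ((R.functor T).map ((ℍ₁.pull f).map (adj.unit.app A)))
        ((R.functor T).map ((ℍ₁.pull f).map (adj.unit.app B))) =
        inv (𝒯₂.tmap ((R.functor T).map (ε.app ((ℍ₁.pull f).obj A)))
          ((R.functor T).map (ε.app ((ℍ₁.pull f).obj B)))) := by
      rw [← cancel_mono (𝒯₂.tmap ((R.functor T).map (ε.app ((ℍ₁.pull f).obj A)))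
          ((R.functor T).map (ε.app ((ℍ₁.pull f).obj B)))), IsIso.inv_hom_id, ← 𝒯₂.tmap_comp,
        ← Functor.map_comp, ← Functor.map_comp, t, t]
      simp
    rw [← e, reassoc_of% key, ← Functor.map_comp, ← 𝒯₁.tmap_comp, t, t]
    simp

/-! ### Compatibility with shifts in each variable -/

/-- The family at a fixed first object, as a natural transformation. -/
@[simps]
def TensorFamily.IsNatural.right {S : 𝒮} {σ : TensorFamily R 𝒯₁ 𝒯₂ S} (hσ : σ.IsNatural)
    (A : H S) :
    R.functor S ⋙ (𝒯₂.tensor S).obj ((R.functor S).obj A) ⟶ (𝒯₁.tensor S).obj A ⋙ R.functor S where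
  app B := σ A B
  naturality B B' b := by
    have := hσ (𝟙 A) b
    rwa [CategoryTheory.Functor.map_id, 𝒯₂.tmap_id_left, 𝒯₁.tmap_id_left] at this

/-- The family at a fixed second object, as a natural transformation. -/
@[simps]
def TensorFamily.IsNatural.left {S : 𝒮} {σ : TensorFamily R 𝒯₁ 𝒯₂ S} (hσ : σ.IsNatural)
    (B : H S) :
    R.functor S ⋙ (𝒯₂.tensor S).flip.obj ((R.functor S).obj B) ⟶
      (𝒯₁.tensor S).flip.obj B ⋙ R.functor S where
  app A := σ A B
  naturality A A' a := by
    have := hσ a (𝟙 B)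
    rwa [CategoryTheory.Functor.map_id, 𝒯₂.tmap_id_right, 𝒯₁.tmap_id_right] at this

/-- Naturality in the fixed variable conjugates one transformation into the other by maps induced by
`i`, which commute with shifts because the tensor products are shift-compatible bifunctors. -/
lemma TensorFamily.IsNatural.commShift_right_of_iso {S : 𝒮} {σ : TensorFamily R 𝒯₁ 𝒯₂ S}
    (hσ : σ.IsNatural) {A A' : H S} (i : A ≅ A') [NatTrans.CommShift (hσ.right A) ℤ] :
    NatTrans.CommShift (hσ.right A') ℤ := by
  have : hσ.right A' =
      Functor.whiskerLeft (R.functor S) ((𝒯₂.tensor S).map ((R.functor S).map i.inv)) ≫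
      hσ.right A ≫ Functor.whiskerRight ((𝒯₁.tensor S).map i.hom) (R.functor S) := by
    ext B
    have := hσ i.hom (𝟙 B)
    rw [CategoryTheory.Functor.map_id, 𝒯₂.tmap_id_right, 𝒯₁.tmap_id_right] at this
    simp [← this, ← NatTrans.comp_app_assoc, ← Functor.map_comp]
  rw [this]
  infer_instance

lemma TensorFamily.IsNatural.commShift_left_of_iso {S : 𝒮} {σ : TensorFamily R 𝒯₁ 𝒯₂ S}
    (hσ : σ.IsNatural) {B B' : H S} (i : B ≅ B') [NatTrans.CommShift (hσ.left B) ℤ] :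
    NatTrans.CommShift (hσ.left B') ℤ := by
  have : hσ.left B' =
      Functor.whiskerLeft (R.functor S) ((𝒯₂.tensor S).flip.map ((R.functor S).map i.inv)) ≫
      hσ.left B ≫ Functor.whiskerRight ((𝒯₁.tensor S).flip.map i.hom) (R.functor S) := by
    ext A
    have := hσ (𝟙 A) i.hom
    rw [CategoryTheory.Functor.map_id, 𝒯₂.tmap_id_left, 𝒯₁.tmap_id_left] at this
    simp [← this, ← Functor.map_comp_assoc]
  rw [this]
  infer_instance

/-- After restriction along f^*, the compatibility square expresses the family over `T` through the
one over `S`, transition maps and monoidality maps, all of which respect shifts. Essential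
surjectivity removes the restriction. -/
lemma TensorFamily.IsNatural.commShift_right_pull {T S : 𝒮} {f : T ⟶ S}
    {σ : TensorFamily R 𝒯₁ 𝒯₂ S} (hσ : σ.IsNatural) {τ : TensorFamily R 𝒯₁ 𝒯₂ T}
    (hτ : τ.IsNatural) (h : ∀ A B, PullCompatible R 𝒯₁ 𝒯₂ f (σ A B) (τ _ _))
    [(ℍ₁.pull f).EssSurj] (A : H S) [NatTrans.CommShift (hσ.right A) ℤ] :
    NatTrans.CommShift (hτ.right ((ℍ₁.pull f).obj A)) ℤ := by
  have m₁ := 𝒯₁.mon_commShift_right f A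
  have m₂ := 𝒯₂.mon_commShift_right f ((R.functor S).obj A)
  let α := (Functor.associator _ _ _).inv ≫
    Functor.whiskerLeft (R.functor S ⋙ ℍ₂.pull f) ((𝒯₂.tensor T).map (R.transApp f A)) ≫
    Functor.whiskerRight (R.trans f).hom _ ≫ (Functor.associator _ _ _).hom
  let β := (Functor.associator _ _ _).inv ≫
    Functor.whiskerRight (𝒯₁.mon f A).hom (R.functor T) ≫ (Functor.associator _ _ _).hom
  let γ := Functor.whiskerLeft (R.functor S) (𝒯₂.mon f ((R.functor S).obj A)).hom ≫
    (Functor.associator _ _ _).inv ≫ Functor.whiskerRight (hσ.right A) (ℍ₂.pull f) ≫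
    (Functor.associator _ _ _).hom ≫ Functor.whiskerLeft _ (R.trans f).hom
  have e : Functor.whiskerLeft (ℍ₁.pull f) (hτ.right ((ℍ₁.pull f).obj A)) = inv α ≫ γ ≫ inv β := by
    rw [← cancel_mono β, ← cancel_epi α]
    simp only [Category.assoc, IsIso.hom_inv_id_assoc, IsIso.inv_hom_id, Category.comp_id]
    ext B
    have := h A B
    simp only [PullCompatible, TensorStructure.tmap] at this
    simp [α, β, γ, this]
  have := NatTrans.CommShift.of_isIso α ℤ
  have := NatTrans.CommShift.of_isIso β ℤ
  have : NatTrans.CommShift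
      (Functor.whiskerLeft (ℍ₁.pull f) (hτ.right ((ℍ₁.pull f).obj A))) ℤ := by
    rw [e]
    infer_instance
  exact commShift_of_whiskerLeft (ℍ₁.pull f) _

lemma TensorFamily.IsNatural.commShift_left_pull {T S : 𝒮} {f : T ⟶ S}
    {σ : TensorFamily R 𝒯₁ 𝒯₂ S} (hσ : σ.IsNatural) {τ : TensorFamily R 𝒯₁ 𝒯₂ T}
    (hτ : τ.IsNatural) (h : ∀ A B, PullCompatible R 𝒯₁ 𝒯₂ f (σ A B) (τ _ _))
    [(ℍ₁.pull f).EssSurj] (B : H S) [NatTrans.CommShift (hσ.left B) ℤ] :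
    NatTrans.CommShift (hτ.left ((ℍ₁.pull f).obj B)) ℤ := by
  let monLeft₁ : ℍ₁.pull f ⋙ (𝒯₁.tensor T).flip.obj ((ℍ₁.pull f).obj B) ⟶
      (𝒯₁.tensor S).flip.obj B ⋙ ℍ₁.pull f :=
    { app := fun A => (𝒯₁.mon f A).hom.app B
      naturality := fun _ _ a => 𝒯₁.mon_naturality f a B }
  let monLeft₂ : ℍ₂.pull f ⋙ (𝒯₂.tensor T).flip.obj ((ℍ₂.pull f).obj ((R.functor S).obj B)) ⟶
      (𝒯₂.tensor S).flip.obj ((R.functor S).obj B) ⋙ ℍ₂.pull f :=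
    { app := fun A => (𝒯₂.mon f A).hom.app ((R.functor S).obj B)
      naturality := fun _ _ a => 𝒯₂.mon_naturality f a ((R.functor S).obj B) }
  have m₁ : NatTrans.CommShift monLeft₁ ℤ := 𝒯₁.mon_commShift_left f B
  have m₂ : NatTrans.CommShift monLeft₂ ℤ := 𝒯₂.mon_commShift_left f ((R.functor S).obj B)
  -- `β` has to be inverted below, and monoidality as a transformation in the first variable comes
  -- only as a morphism.
  have : IsIso monLeft₁ := by
    have (A : _) : IsIso (monLeft₁.app A) := by dsimp [monLeft₁]; infer_instance
    exact NatIso.isIso_of_isIso_app _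
  -- The order matches `tmap`, which acts on the first variable before the second; here the first
  -- variable is the varying one.
  let α := (Functor.associator _ _ _).inv ≫
    Functor.whiskerRight (R.trans f).hom _ ≫
    Functor.whiskerLeft (ℍ₁.pull f ⋙ R.functor T) ((𝒯₂.tensor T).flip.map (R.transApp f B)) ≫
    (Functor.associator _ _ _).hom
  let β := (Functor.associator _ _ _).inv ≫
    Functor.whiskerRight monLeft₁ (R.functor T) ≫ (Functor.associator _ _ _).hom
  let γ := Functor.whiskerLeft (R.functor S) monLeft₂ ≫
    (Functor.associator _ _ _).inv ≫ Functor.whiskerRight (hσ.left B) (ℍ₂.pull f) ≫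
    (Functor.associator _ _ _).hom ≫ Functor.whiskerLeft _ (R.trans f).hom
  have e : Functor.whiskerLeft (ℍ₁.pull f) (hτ.left ((ℍ₁.pull f).obj B)) = inv α ≫ γ ≫ inv β := by
    rw [← cancel_mono β, ← cancel_epi α]
    simp only [Category.assoc, IsIso.hom_inv_id_assoc, IsIso.inv_hom_id, Category.comp_id]
    ext A
    have := h A B
    simp only [PullCompatible, TensorStructure.tmap] at this
    simp [α, β, γ, monLeft₁, monLeft₂, this]
  have := NatTrans.CommShift.of_isIso α ℤ
  have := NatTrans.CommShift.of_isIso β ℤ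
  have : NatTrans.CommShift
      (Functor.whiskerLeft (ℍ₁.pull f) (hτ.left ((ℍ₁.pull f).obj B))) ℤ := by
    rw [e]
    infer_instance
  exact commShift_of_whiskerLeft (ℍ₁.pull f) _

end FiberedMorphism

variable {R : FiberedMorphism ℍ₁ ℍ₂}
  {𝒯₁ : TensorStructure ℍ₁} {𝒯₂ : TensorStructure ℍ₂}

open FiberedMorphism

namespace MorphismTensorStructure

/-! ### Tensor structures as compatible natural families -/

section Family

variable (ρ : MorphismTensorStructure R 𝒯₁ 𝒯₂)

/-- The underlying families of morphisms of a tensor structure. -/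
abbrev family (S : 𝒮) : TensorFamily R 𝒯₁ 𝒯₂ S := fun A B => (ρ.rho S A).hom.app B

lemma family_isNatural (S : 𝒮) : (ρ.family S).IsNatural := by
  intro A A' B B' a b
  have h₁ := (ρ.rho S A').hom.naturality b
  have h₂ := ρ.rho_naturality S a B
  dsimp at h₁
  simp only [TensorStructure.tmap, Category.assoc, h₁, reassoc_of% h₂, Functor.map_comp]

lemma family_pullCompatible {T S : 𝒮} (f : T ⟶ S) (A B : H S) :
    PullCompatible R 𝒯₁ 𝒯₂ f (ρ.family S A B) (ρ.family T _ _) := by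
  rw [PullCompatible, TensorStructure.tmap, Category.assoc]
  exact ρ.rho_pull f A B

/-- A tensor structure is determined by its underlying families of morphisms. -/
lemma ext_family {ρ ρ' : MorphismTensorStructure R 𝒯₁ 𝒯₂}
    (h : ∀ S, ρ.family S = ρ'.family S) : ρ = ρ' := by
  ext S A B
  exact congr_fun (congr_fun (h S) A) B

/-- Construct a tensor structure from compatible natural families of isomorphisms. -/
noncomputable def ofFamily (σ : ∀ S, TensorFamily R 𝒯₁ 𝒯₂ S) (hσ : ∀ S, (σ S).IsNatural)
    (iso : ∀ S A B, IsIso (σ S A B))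
    (right : ∀ S A, NatTrans.CommShift ((hσ S).right A) ℤ)
    (left : ∀ S B, NatTrans.CommShift ((hσ S).left B) ℤ)
    (pull : ∀ {T S : 𝒮} (f : T ⟶ S) (A B : H S),
      PullCompatible R 𝒯₁ 𝒯₂ f (σ S A B) (σ T _ _)) :
    MorphismTensorStructure R 𝒯₁ 𝒯₂ where
  rho S A :=
    have : ∀ B, IsIso (((hσ S).right A).app B) := iso S A
    have := NatIso.isIso_of_isIso_app ((hσ S).right A)
    asIso ((hσ S).right A)
  rho_naturality S _ _ a B := ((hσ S).left B).naturality a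
  rho_commShift_right := right
  rho_commShift_left := left
  rho_pull f A B := by
    have := pull f A B
    rwa [PullCompatible, TensorStructure.tmap, Category.assoc] at this

end Family

/-! ### Extensions along one map to an object of the subcategory -/

section Restricted

variable {P : ObjectProperty 𝒮}
  (ρ : MorphismTensorStructure (R.restrict P) (𝒯₁.restrict P) (𝒯₂.restrict P))

/-- The families of morphisms underlying a tensor structure over a full subcategory. -/
def familyOn {Y : 𝒮} (hY : P Y) : TensorFamily R 𝒯₁ 𝒯₂ Y := ρ.family ⟨Y, hY⟩

lemma familyOn_isNatural {Y : 𝒮} (hY : P Y) : (ρ.familyOn hY).IsNatural :=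
  fun _ _ _ _ a b => ρ.family_isNatural ⟨Y, hY⟩ a b

lemma familyOn_pullCompatible {X Y : 𝒮} (hX : P X) (hY : P Y) (f : X ⟶ Y) (A B : H Y) :
    PullCompatible R 𝒯₁ 𝒯₂ f (ρ.familyOn hY A B) (ρ.familyOn hX _ _) :=
  ρ.family_pullCompatible (T := ⟨X, hX⟩) (S := ⟨Y, hY⟩) (ObjectProperty.homMk f) A B

/-- A family over `S` is an extension of `ρ` along `f : S ⟶ Y` if it is compatible with `ρ` under
inverse image along `f`. -/
def IsExtensionAlong {S Y : 𝒮} (hY : P Y) (f : S ⟶ Y) (σ : TensorFamily R 𝒯₁ 𝒯₂ S) : Prop :=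
  ∀ A B, PullCompatible R 𝒯₁ 𝒯₂ f (ρ.familyOn hY A B) (σ _ _)

variable {ρ}

/-- `ρ` is already compatible along `f`, a morphism between objects of `P`, so the two
compatibilities compose. -/
lemma IsExtensionAlong.comp {S X Y : 𝒮} {hX : P X} {e : S ⟶ X}
    {σ : TensorFamily R 𝒯₁ 𝒯₂ S} (hσ : σ.IsNatural) (h : ρ.IsExtensionAlong hX e σ) (hY : P Y)
    {f : X ⟶ Y} {g : S ⟶ Y} (w : e ≫ f = g) : ρ.IsExtensionAlong hY g σ := fun A B =>
  (pullCompatible_comp_iff w (ρ.familyOn_pullCompatible hX hY f A B) hσ).1 (h _ _)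

lemma IsExtensionAlong.unique {S Y : 𝒮} {hY : P Y} {e : S ⟶ Y} [(ℍ₁.pull e).EssSurj]
    {σ σ' : TensorFamily R 𝒯₁ 𝒯₂ S} (hσ : σ.IsNatural) (hσ' : σ'.IsNatural)
    (h : ρ.IsExtensionAlong hY e σ) (h' : ρ.IsExtensionAlong hY e σ') : σ = σ' :=
  hσ.ext_of_essSurj hσ' (ℍ₁.pull e) fun A B => pullCompatible_congr (h A B) (h' A B)

/-- On the image of e^* the value is the pullback of an isomorphism; naturality carries this to all
objects. -/
lemma IsExtensionAlong.isIso {S Y : 𝒮} {hY : P Y} {e : S ⟶ Y} [(ℍ₁.pull e).EssSurj]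
    {σ : TensorFamily R 𝒯₁ 𝒯₂ S} (hσ : σ.IsNatural) (h : ρ.IsExtensionAlong hY e σ) (A B : H S) :
    IsIso (σ A B) := by
  let i := (ℍ₁.pull e).objObjPreimageIso A
  let j := (ℍ₁.pull e).objObjPreimageIso B
  have : IsIso (ρ.familyOn hY ((ℍ₁.pull e).objPreimage A) ((ℍ₁.pull e).objPreimage B)) := by
    dsimp only [familyOn]
    infer_instance
  have := isIso_of_pullCompatible (h ((ℍ₁.pull e).objPreimage A) ((ℍ₁.pull e).objPreimage B))
  have : IsIso (𝒯₂.tmap ((R.functor S).map i.hom) ((R.functor S).map j.hom) ≫ σ A B) := by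
    rw [hσ]
    infer_instance
  exact IsIso.of_isIso_comp_left (𝒯₂.tmap ((R.functor S).map i.hom) ((R.functor S).map j.hom)) _

lemma IsExtensionAlong.commShift_right {S Y : 𝒮} {hY : P Y} {e : S ⟶ Y} [(ℍ₁.pull e).EssSurj]
    {σ : TensorFamily R 𝒯₁ 𝒯₂ S} (hσ : σ.IsNatural) (h : ρ.IsExtensionAlong hY e σ) (A : H S) :
    NatTrans.CommShift (hσ.right A) ℤ := by
  have : NatTrans.CommShift
      ((ρ.familyOn_isNatural hY).right ((ℍ₁.pull e).objPreimage A)) ℤ :=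
    ρ.rho_commShift_right ⟨Y, hY⟩ _
  have := (ρ.familyOn_isNatural hY).commShift_right_pull hσ h ((ℍ₁.pull e).objPreimage A)
  exact hσ.commShift_right_of_iso ((ℍ₁.pull e).objObjPreimageIso A)

lemma IsExtensionAlong.commShift_left {S Y : 𝒮} {hY : P Y} {e : S ⟶ Y} [(ℍ₁.pull e).EssSurj]
    {σ : TensorFamily R 𝒯₁ 𝒯₂ S} (hσ : σ.IsNatural) (h : ρ.IsExtensionAlong hY e σ) (B : H S) :
    NatTrans.CommShift (hσ.left B) ℤ := by
  have : NatTrans.CommShift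
      ((ρ.familyOn_isNatural hY).left ((ℍ₁.pull e).objPreimage B)) ℤ :=
    ρ.rho_commShift_left ⟨Y, hY⟩ _
  have := (ρ.familyOn_isNatural hY).commShift_left_pull hσ h ((ℍ₁.pull e).objPreimage B)
  exact hσ.commShift_left_of_iso ((ℍ₁.pull e).objObjPreimageIso B)

end Restricted

/-! ### Independence of the embedding and arbitrary inverse images -/

section Smooth

variable [HasFiniteProducts 𝒮] [HasInitial 𝒮] {sm cl : MorphismProperty 𝒮}
  {ρ : MorphismTensorStructure (R.restrict (smoothObjects sm)) (𝒯₁.restrict (smoothObjects sm))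
    (𝒯₂.restrict (smoothObjects sm))}

/-- An extension along a closed immersion into a smooth object is an extension along every
morphism to a smooth object. -/
lemma IsExtensionAlong.of_closed (h𝒮 : IsFactorizationSetting sm cl) (hℍ₁ : ℍ₁.IsLocalic sm cl)
    {S Y : 𝒮} {hY : smoothObjects sm Y} {e : S ⟶ Y} (he : cl e)
    {σ : TensorFamily R 𝒯₁ 𝒯₂ S} (hσ : σ.IsNatural) (h : ρ.IsExtensionAlong hY e σ)
    {X : 𝒮} (hX : smoothObjects sm X) (f : S ⟶ X) : ρ.IsExtensionAlong hX f σ := by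
  have hYX := h𝒮.smoothObjects_prod hY hX
  obtain ⟨G, adj, _, _⟩ := hℍ₁.exists_rightAdjoint_pull _ (h𝒮.cl_lift he f)
  obtain ⟨τ, hτ, hext⟩ := (ρ.familyOn_isNatural hYX).exists_pull (prod.lift e f) adj
  have hext : ρ.IsExtensionAlong hYX (prod.lift e f) τ := hext
  have := hℍ₁.essSurj he
  -- The family `τ` built from the embedding (e, f) extends `ρ` along both components; uniqueness
  -- along `e` lets it replace `σ`.
  rw [h.unique hσ hτ (hext.comp hτ hY (prod.lift_fst e f))]
  exact hext.comp hτ hX (prod.lift_snd e f)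

-- Quantifying over all maps to smooth objects frees the family from the embedding used to build it,
-- so families over different objects can be compared.
variable (ρ) in
lemma exists_isExtensionAlong (h𝒮 : IsFactorizationSetting sm cl) (hℍ₁ : ℍ₁.IsLocalic sm cl)
    (S : 𝒮) : ∃ σ : TensorFamily R 𝒯₁ 𝒯₂ S, σ.IsNatural ∧
      ∀ (Y : 𝒮) (hY : smoothObjects sm Y) (f : S ⟶ Y), ρ.IsExtensionAlong hY f σ := by
  obtain ⟨Y, e, he, hY⟩ := h𝒮.exists_embedding S
  obtain ⟨G, adj, _, _⟩ := hℍ₁.exists_rightAdjoint_pull _ he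
  obtain ⟨σ, hσ, h⟩ := (ρ.familyOn_isNatural hY).exists_pull e adj
  exact ⟨σ, hσ, fun X hX f => IsExtensionAlong.of_closed h𝒮 hℍ₁ he hσ h hX f⟩

/-- Extensions are compatible with inverse images. -/
lemma pullCompatible_of_isExtensionAlong (h𝒮 : IsFactorizationSetting sm cl)
    (hℍ₁ : ℍ₁.IsLocalic sm cl) {T S : 𝒮} (f : T ⟶ S) {σ : TensorFamily R 𝒯₁ 𝒯₂ S}
    (hσ : σ.IsNatural)
    (h : ∀ (Y : 𝒮) (hY : smoothObjects sm Y) (g : S ⟶ Y), ρ.IsExtensionAlong hY g σ)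
    {τ : TensorFamily R 𝒯₁ 𝒯₂ T} (hτ : τ.IsNatural)
    (h' : ∀ (Y : 𝒮) (hY : smoothObjects sm Y) (g : T ⟶ Y), ρ.IsExtensionAlong hY g τ) (A B : H S) :
    PullCompatible R 𝒯₁ 𝒯₂ f (σ A B) (τ _ _) := by
  obtain ⟨Y, e, he, hY⟩ := h𝒮.exists_embedding S
  have := hℍ₁.essSurj he
  -- It suffices to treat objects e^* M. There `σ` extends `ρ` along `e` and `τ` along `f ≫ e`, and
  -- the composition criterion, read backwards, yields compatibility along `f`.
  exact PullCompatible.of_iso hσ hτ ((ℍ₁.pull e).objObjPreimageIso A)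
    ((ℍ₁.pull e).objObjPreimageIso B)
    ((pullCompatible_comp_iff rfl (h Y hY e _ _) hτ).2 (h' Y hY (f ≫ e) _ _))

end Smooth

end MorphismTensorStructure

end Fibered

end LocalicFibered

/-! ### The extension theorem -/

theorem theorem4 {𝒮 : Type u} [Category.{v} 𝒮] [HasFiniteProducts 𝒮] [HasInitial 𝒮]
    {sm cl : MorphismProperty 𝒮} (h𝒮 : LocalicFibered.IsStratifiedSetting sm cl)
    {H₁ : 𝒮 → Type w₁} [∀ S, Category.{w₁'} (H₁ S)] [∀ S, HasZeroObject (H₁ S)]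
    [∀ S, HasShift (H₁ S) ℤ] [∀ S, Preadditive (H₁ S)]
    [∀ S, ∀ n : ℤ, (shiftFunctor (H₁ S) n).Additive]
    [∀ S, Pretriangulated (H₁ S)] [∀ S, IsTriangulated (H₁ S)]
    {H₂ : 𝒮 → Type w₂} [∀ S, Category.{w₂'} (H₂ S)] [∀ S, HasZeroObject (H₂ S)]
    [∀ S, HasShift (H₂ S) ℤ] [∀ S, Preadditive (H₂ S)]
    [∀ S, ∀ n : ℤ, (shiftFunctor (H₂ S) n).Additive]
    [∀ S, Pretriangulated (H₂ S)] [∀ S, IsTriangulated (H₂ S)]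
    (ℍ₁ : LocalicFibered.FiberedCategory H₁) (hℍ₁ : ℍ₁.IsLocalic sm cl)
    (ℍ₂ : LocalicFibered.FiberedCategory H₂) (hℍ₂ : ℍ₂.IsLocalic sm cl)
    (𝒯₁ : LocalicFibered.TensorStructure ℍ₁) (h𝒯₁ : 𝒯₁.IsLocalic sm)
    (𝒯₂ : LocalicFibered.TensorStructure ℍ₂) (h𝒯₂ : 𝒯₂.IsLocalic sm)
    (R : LocalicFibered.FiberedMorphism ℍ₁ ℍ₂) (hR : R.IsLocalic sm)
    (ρ : LocalicFibered.MorphismTensorStructure (R.restrict (LocalicFibered.smoothObjects sm))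
      (𝒯₁.restrict (LocalicFibered.smoothObjects sm))
      (𝒯₂.restrict (LocalicFibered.smoothObjects sm))) :
    ∃! ρ' : LocalicFibered.MorphismTensorStructure R 𝒯₁ 𝒯₂,
      ρ'.restrict (LocalicFibered.smoothObjects sm) = ρ := by
  have h := h𝒮.toIsFactorizationSetting
  choose σ hσ hext using fun S => ρ.exists_isExtensionAlong h hℍ₁ S
  have unique (S : 𝒮) (τ : R.TensorFamily 𝒯₁ 𝒯₂ S) (hτ : τ.IsNatural)
      (hext' : ∀ (Y : 𝒮) (hY : LocalicFibered.smoothObjects sm Y) (e : S ⟶ Y),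
        ρ.IsExtensionAlong hY e τ) : τ = σ S := by
    obtain ⟨Y, e, he, hY⟩ := h.exists_embedding S
    have := hℍ₁.essSurj he
    exact (hext' Y hY e).unique hτ (hσ S) (hext S Y hY e)
  refine ⟨.ofFamily σ hσ (fun S A B => ?_) (fun S A => ?_) (fun S B => ?_) (fun f A B => ?_), ?_,
    fun ρ' hρ' => ?_⟩
  · obtain ⟨Y, e, he, hY⟩ := h.exists_embedding S
    have := hℍ₁.essSurj he
    exact (hext S Y hY e).isIso (hσ S) A B
  · obtain ⟨Y, e, he, hY⟩ := h.exists_embedding S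
    have := hℍ₁.essSurj he
    exact (hext S Y hY e).commShift_right (hσ S) A
  · obtain ⟨Y, e, he, hY⟩ := h.exists_embedding S
    have := hℍ₁.essSurj he
    exact (hext S Y hY e).commShift_left (hσ S) B
  · exact LocalicFibered.MorphismTensorStructure.pullCompatible_of_isExtensionAlong h hℍ₁ f
      (hσ _) (hext _) (hσ _) (hext _) A B
  · refine LocalicFibered.MorphismTensorStructure.ext_family fun Y => ?_
    -- Over a smooth object, `ρ` is itself an extension along every map to a smooth object, hence
    -- equals the constructed family.
    exact (unique Y.obj (ρ.familyOn Y.property) (ρ.familyOn_isNatural Y.property)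
      fun X hX e => ρ.familyOn_pullCompatible Y.property hX e).symm
  · subst hρ'
    exact LocalicFibered.MorphismTensorStructure.ext_family fun S =>
      -- Compatibility of `ρ'` with inverse images along maps from S to smooth objects says exactly
      -- that its family extends its own restriction.
      unique S (ρ'.family S) (ρ'.family_isNatural S) fun X hX e => ρ'.family_pullCompatible e
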